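/- \textbf{Setting.} There are $n$ buyers and $k$ sellers; a seller set is a subset $\gamma$ of the $k$ sellers, and $D_h(\gamma,\gamma')=|\gamma\,\triangle\,\gamma'|/k$ is the normalized Hamming distance. In one market round, buyer $i$ ordering $\gamma$ obtains a random performance value $P_i(\gamma)\in[0,1]$ at a fixed cost $c(\gamma)\in[0,1]$ (with $P_i(\emptyset)=0$, $c(\emptyset)=0$); her net gain is $G_i(\gamma)=P_i(\gamma)-c(\gamma)$. If buyer $j$ orders $\gamma_j$, buyer $i\neq j$ suffers a random, integrable externality $E_{ij}(\gamma_j)$, where $\sum_{j\ne i}E_{ji}(\gamma)\in[0,1]$ for all $i$ and $\gamma$. All these variables may be arbitrarily correlated within a round. Fix $\alpha\in[0,1]$. Under the order profile $S=(\gamma_1,\dots,\gamma_n)$ buyer $i$ pays the transaction cost $\mathcal T_i(S)=\alpha\bigl(\sum_{j\ne i}E_{ji}(\gamma_i)-\sum_{j\ne i}E_{ij}(\gamma_j)\bigr)$ and has utility $U_i(S)=G_i(\gamma_i)-\sum_{j\ne i}E_{ij}(\gamma_j)-\mathcal T_i(S)$. Her effective utility is $U^e_i(\gamma)=G_i(\gamma)-\alpha\sum_{j\ne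 i}E_{ji}(\gamma)$, with mean $\bar u^e_i(\gamma)$. Let $\gamma_i^d$ be a dominant strategy of buyer $i$ under full information, i.e. an order that maximizes her expected utility $\mathbb E[U_i(S)]$ whatever the others order. \textbf{Closeness} (parameter $\lambda>0$). For every seller set $\gamma$, $$\bar u^e_i(\gamma_i^d)-\bar u^e_i(\gamma)\in\bigl[\lambda\bigl(D_h(\gamma,\gamma_i^d)-\tfrac1k\bigr),\ \lambda D_h(\gamma,\gamma_i^d)\bigr].$$ \textbf{Algorithm.} The market is repeated for $T\ge 2$ rounds; the outcome of each round is a fresh draw from the same joint distribution, independent of everything known when the orders of that round are placed. For buyer $i$ let $n_t(\gamma)$ be the number of rounds before $t$ in which she ordered $\gamma$, $\hat u_t(\gamma)$ the mean of the effective utilities she observed in these rounds ($0$ if there are none), and $c_t(\gamma)=\sqrt{12\log T/(n_t(\gamma)+1)}$. An active set $\gamma'$ covers $\gamma$ at round $t$ if $\lambda D_h(\gamma,\gamma')\le c_t(\gamma')$. Initially one arbitrary seller set is active. In each round $t=1,\dots,T$: if some seller set is not covered by any active set, one arbitrary uncovered seller set becomes active; then buyer $i$ orders an active seller set $\gamma_i^t$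 that maximizes $\hat u_t(\gamma)+2c_t(\gamma)$ over the active $\gamma$. (Arbitrary choices may be randomized and may use all past information.) \textbf{Theorem.} For every $\lambda>0$ there is a constant $C>0$ depending only on $\lambda$ such that for all $n,k$, all such markets, all $\alpha\in[0,1]$, all $T\ge2$, and every buyer $i$ that satisfies closeness with parameter $\lambda$ and runs this algorithm, her expected online effective regret satisfies $$R^i_d(T)=\mathbb E\Bigl[\sum_{t=1}^{T}\bigl(U^e_i(\gamma_i^d)-U^e_i(\gamma_i^t)\bigr)\Bigr]\ \le\ C\,k^2\sqrt{T\log T}+C\,k^3\log^2(T)\,2^{3k/4},$$ where in the $t$-th summand the effective utilities are those realized in round $t$. -/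

import Mathlib

open MeasureTheory ProbabilityTheory

/-- A seller set (an order): a subset of the `k` sellers. -/
abbrev SellerSet (k : ℕ) : Type := Finset (Fin k)

/-- Normalized Hamming distance between two seller sets: the number of sellers in which they
differ, divided by `k`. -/
noncomputable def hammingFrac {k : ℕ} (γ γ' : SellerSet k) : ℝ :=
  ((symmDiff γ γ').card : ℝ) / (k : ℝ)

/-- A fixed-price data market with `n` buyers and `k` sellers. A point of `X` is the random outcome
of one market round, drawn from `law`; the performance gains and externalities are random variables
on `X`, with an arbitrary joint distribution. -/
structure DataMarket (n k : ℕ) (X : Type*) [MeasurableSpace X] where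
  /-- distribution of the outcome of one round -/
  law : Measure X
  isProb : IsProbabilityMeasure law
  /-- `perf i γ` is the value to buyer `i` of the performance increase due to buying from `γ` -/
  perf : Fin n → SellerSet k → X → ℝ
  /-- `cost γ` is the price charged by the sellers in `γ` -/
  cost : SellerSet k → ℝ
  /-- `ext i j γ` is the negative externality that buyer `i` suffers when buyer `j` orders `γ` -/
  ext : Fin n → Fin n → SellerSet k → X → ℝ
  perf_measurable : ∀ i γ, Measurable (perf i γ)
  perf_mem : ∀ i γ x, perf i γ x ∈ Set.Icc (0 : ℝ) 1
  perf_empty : ∀ i x, perf i ∅ x = 0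
  cost_mem : ∀ γ, cost γ ∈ Set.Icc (0 : ℝ) 1
  cost_empty : cost ∅ = 0
  ext_measurable : ∀ i j γ, Measurable (ext i j γ)
  ext_integrable : ∀ i j γ, Integrable (ext i j γ) law
  /-- the total externality created by a buyer lies in `[0, 1]` -/
  ext_sum_mem : ∀ i γ x, ∑ j ∈ Finset.univ.erase i, ext j i γ x ∈ Set.Icc (0 : ℝ) 1

namespace DataMarket

variable {n k : ℕ} {X : Type*} [MeasurableSpace X]

/-- Net gain `G_i(γ)`: performance increase minus cost. -/
def gain (M : DataMarket n k X) (i : Fin n) (γ : SellerSet k) (x : X) : ℝ :=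
  M.perf i γ x - M.cost γ

/-- Transaction cost charged to buyer `i` under the order profile `S`: `α` times the externality
that she causes minus the externality that she suffers. -/
def transactionCost (M : DataMarket n k X) (α : ℝ) (i : Fin n) (S : Fin n → SellerSet k) (x : X) :
    ℝ :=
  α * (∑ j ∈ Finset.univ.erase i, M.ext j i (S i) x - ∑ j ∈ Finset.univ.erase i, M.ext i j (S j) x)

/-- Utility `U_i(S)` of buyer `i` under the order profile `S`. -/
def utility (M : DataMarket n k X) (α : ℝ) (i : Fin n) (S : Fin n → SellerSet k) (x : X) : ℝ :=
  M.gain i (S i) x - ∑ j ∈ Finset.univ.erase i, M.ext i j (S j) x - M.transactionCost α i S x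

/-- Expected utility of buyer `i` under the order profile `S`. -/
noncomputable def meanUtility (M : DataMarket n k X) (α : ℝ) (i : Fin n)
    (S : Fin n → SellerSet k) : ℝ :=
  ∫ x, M.utility α i S x ∂M.law

/-- `γd` is a dominant strategy of buyer `i` under full information: whatever the orders of the
other buyers are, no order gives buyer `i` a larger expected utility than `γd`. -/
def IsDominantStrategy (M : DataMarket n k X) (α : ℝ) (i : Fin n) (γd : SellerSet k) : Prop :=
  ∀ S : Fin n → SellerSet k, M.meanUtility α i S ≤ M.meanUtility α i (Function.update S i γd)

/-- Effective utility `U^e_i(γ)`: the part of the utility of buyer `i` that depends on her order. -/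
def effUtility (M : DataMarket n k X) (α : ℝ) (i : Fin n) (γ : SellerSet k) (x : X) : ℝ :=
  M.gain i γ x - α * ∑ j ∈ Finset.univ.erase i, M.ext j i γ x

/-- Expected effective utility of buyer `i`. -/
noncomputable def meanEffUtility (M : DataMarket n k X) (α : ℝ) (i : Fin n) (γ : SellerSet k) : ℝ :=
  ∫ x, M.effUtility α i γ x ∂M.law

/-- Closeness with parameter `lam`, relative to the seller set `γd`: the gap in expected effective
utility between `γd` and any `γ` is their Hamming distance times `lam`, up to `lam / k`. -/
def Closeness (M : DataMarket n k X) (α lam : ℝ) (i : Fin n) (γd : SellerSet k) : Prop :=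
  ∀ γ : SellerSet k,
    M.meanEffUtility α i γd - M.meanEffUtility α i γ ∈
      Set.Icc (lam * (hammingFrac γ γd - 1 / (k : ℝ))) (lam * hammingFrac γ γd)

variable {Ω : Type*} {mΩ : MeasurableSpace Ω}

/-- The repeated market: `ξ t` is the outcome of round `t` (rounds are numbered from `0`) and `ℱ t`
is the information available when the orders of round `t` are placed, which may include private
randomization of the buyers. Each outcome is a fresh draw from the law of the market. -/
structure IsRepeatedMarket (M : DataMarket n k X) (P : Measure Ω) (ℱ : Filtration ℕ mΩ)
    (ξ : ℕ → Ω → X) : Prop where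
  adapted : ∀ t, Measurable[ℱ (t + 1)] (ξ t)
  map_eq : ∀ t, P.map (ξ t) = M.law
  indep : ∀ t, Indep (MeasurableSpace.comap (ξ t) inferInstance) (ℱ t) P

end DataMarket

/-- The number of rounds before round `t` in which `γ` was ordered, when `order s` is the order of
round `s`. -/
def pullCount {k : ℕ} (order : ℕ → SellerSet k) (t : ℕ) (γ : SellerSet k) : ℕ :=
  ((Finset.range t).filter fun s => order s = γ).card

/-- Confidence radius of `γ` at round `t`, for the horizon `T`. -/
noncomputable def confRadius {k : ℕ} (T : ℕ) (order : ℕ → SellerSet k) (t : ℕ)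
    (γ : SellerSet k) : ℝ :=
  Real.sqrt (12 * Real.log T / ((pullCount order t γ : ℝ) + 1))

/-- `γ` is covered at round `t` by some seller set in `active`. -/
def IsCovered {k : ℕ} (lam : ℝ) (T : ℕ) (order : ℕ → SellerSet k) (t : ℕ)
    (active : Finset (SellerSet k)) (γ : SellerSet k) : Prop :=
  ∃ γ' ∈ active, lam * hammingFrac γ γ' ≤ confRadius T order t γ'

namespace DataMarket

variable {n k : ℕ} {X : Type*} [MeasurableSpace X]

/-- Empirical mean of the effective utilities that buyer `i` observed for `γ` before round `t`,
when `x s` is the outcome of round `s`. It is `0` if `γ` has not been ordered yet. -/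
noncomputable def empMean (M : DataMarket n k X) (α : ℝ) (i : Fin n) (x : ℕ → X)
    (order : ℕ → SellerSet k) (t : ℕ) (γ : SellerSet k) : ℝ :=
  (∑ s ∈ (Finset.range t).filter fun s => order s = γ, M.effUtility α i γ (x s)) /
    (pullCount order t γ : ℝ)

/-- Upper confidence bound of `γ` at round `t`. -/
noncomputable def ucb (M : DataMarket n k X) (α : ℝ) (T : ℕ) (i : Fin n) (x : ℕ → X)
    (order : ℕ → SellerSet k) (t : ℕ) (γ : SellerSet k) : ℝ :=
  M.empMean α i x order t γ + 2 * confRadius T order t γ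

/-- One realization of the zooming algorithm of buyer `i` over `T` rounds. `active t` is the active
set at the beginning of round `t`, `active (t + 1)` the one after the activation step of round `t`,
and `order t` is the order placed in round `t`. The initial seller set, the uncovered seller set
that is activated, and the maximizer of the UCB value may be any admissible ones. -/
structure IsZoomingPath (M : DataMarket n k X) (α lam : ℝ) (T : ℕ) (i : Fin n) (x : ℕ → X)
    (active : ℕ → Finset (SellerSet k)) (order : ℕ → SellerSet k) : Prop where
  init : ∃ γ, active 0 = {γ}
  activate : ∀ t < T, (∃ γ, ¬ IsCovered lam T order t (active t) γ) →
    ∃ γ, ¬ IsCovered lam T order t (active t) γ ∧ active (t + 1) = insert γ (active t)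
  keep : ∀ t < T, (∀ γ, IsCovered lam T order t (active t) γ) → active (t + 1) = active t
  order_mem : ∀ t < T, order t ∈ active (t + 1)
  order_max : ∀ t < T, ∀ γ ∈ active (t + 1),
    M.ucb α T i x order t γ ≤ M.ucb α T i x order t (order t)

variable {Ω : Type*} {mΩ : MeasurableSpace Ω}

/-- Buyer `i` runs the zooming algorithm in the repeated market: every realization is one of the
algorithm, and the order of each round depends only on the information available when it is
placed. -/
structure RunsZooming (M : DataMarket n k X) (α lam : ℝ) (T : ℕ) (i : Fin n) (ℱ : Filtration ℕ mΩ)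
    (ξ : ℕ → Ω → X) (active : ℕ → Ω → Finset (SellerSet k)) (order : ℕ → Ω → SellerSet k) :
    Prop where
  nonanticipating : ∀ t < T, ∀ γ, MeasurableSet[ℱ t] {ω | order t ω = γ}
  path : ∀ ω, M.IsZoomingPath α lam T i (fun t => ξ t ω) (fun t => active t ω) (fun t => order t ω)

/-- Expected online effective regret of buyer `i` over `T` rounds, against `γd`. -/
noncomputable def effRegret (M : DataMarket n k X) (α : ℝ) (i : Fin n) (P : Measure Ω)
    (ξ : ℕ → Ω → X) (order : ℕ → Ω → SellerSet k) (γd : SellerSet k) (T : ℕ) : ℝ :=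
  ∫ ω, ∑ t ∈ Finset.range T,
    (M.effUtility α i γd (ξ t ω) - M.effUtility α i (order t ω) (ξ t ω)) ∂P

end DataMarket

/-! The proof combines the confidence-bound analysis of zooming with a packing bound for binary
codes.

Suppose all confidence intervals are correct and `lam ^ 2 ≤ 12 log T`. Every round has an active set
covering `γd`, and the upper half of closeness makes its index at least the mean of `γd`; so an
ordered set has gap at most three radii (`gap_order_le`). Hence a set ordered `N` times with gap `Δ`
satisfies `N Δ² ≤ 108 log T`. A set is activated only when it is farther from each active set than
that set's radius allows, so active sets are separated in proportion to the gap of one of the two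
(`separated`).

The lower half of closeness turns gaps back into distances: active sets at distance `d` from `γd`
are more than `4 (d - 1) / 13` apart. After translation by `γd` they form a constant-weight code, of
size `O(2 ^ (3k/4))` (`card_le_of_constant_weight`). There are `k` such spheres. Sets at distance at
least 2 have gap at least `lam / k` and each cost `O(k log T / lam)`. In the unit ball the gap has
no positive lower bound, but there are only `k + 1` sets, each costing `O(√(T log T))`.

Orders are adaptive, so concentration uses an exponential supermartingale for the first `m` orders
of a set, with a union over `m`, sets and signs. The failure event adds at most `lam * 2 ^ (k + 1) /
T`, harmless once `T > 2 ^ (3k/4)`; for smaller `T` the trivial bound `lam * T` suffices. -/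

/-! ### Packing bounds for codes in the Hamming cube. -/

/-- Packing bound for constant-weight codes: the `(d - r)`-element subsets of the code words are
pairwise distinct when the code words are more than `2 r` apart. -/
lemma card_mul_choose_le_of_separated {k d r : ℕ} (A : Finset (SellerSet k)) (hr : r ≤ d)
    (hA : ∀ x ∈ A, x.card = d)
    (hsep : ∀ x ∈ A, ∀ y ∈ A, x ≠ y → 2 * r < (symmDiff x y).card) :
    A.card * d.choose r ≤ k.choose (d - r) := by
  have hdisj : (A : Set (SellerSet k)).PairwiseDisjoint (Finset.powersetCard (d - r)) := by
    intro x hx y hy hxy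
    refine Finset.disjoint_left.2 fun z hzx hzy => ?_
    rw [Finset.mem_powersetCard] at hzx hzy
    have h := hsep x hx y hy hxy
    have hsub : symmDiff x y ⊆ (x \ z) ∪ (y \ z) := by
      intro a ha
      rw [Finset.mem_symmDiff] at ha
      simp only [Finset.mem_union, Finset.mem_sdiff]
      rcases ha with ⟨h1, h2⟩ | ⟨h1, h2⟩
      · exact Or.inl ⟨h1, fun h3 => h2 (hzy.1 h3)⟩
      · exact Or.inr ⟨h1, fun h3 => h2 (hzx.1 h3)⟩
    have h1 := (Finset.card_le_card hsub).trans (Finset.card_union_le _ _)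
    rw [Finset.card_sdiff_of_subset hzx.1, Finset.card_sdiff_of_subset hzy.1,
      hA x hx, hA y hy, hzx.2] at h1
    omega
  have hcard := Finset.card_biUnion hdisj
  have hsum : ∑ x ∈ A, (Finset.powersetCard (d - r) x).card = A.card * d.choose r := by
    rw [Finset.sum_congr rfl (g := fun _ => d.choose r), Finset.sum_const, smul_eq_mul]
    intro x hx
    rw [Finset.card_powersetCard, hA x hx, Nat.choose_symm hr]
  rw [← hsum, ← hcard]
  refine (Finset.card_le_card (t := Finset.powersetCard (d - r) Finset.univ) ?_).trans ?_
  · intro z hz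
    rw [Finset.mem_biUnion] at hz
    obtain ⟨x, -, hx⟩ := hz
    rw [Finset.mem_powersetCard] at hx ⊢
    exact ⟨Finset.subset_univ _, hx.2⟩
  · rw [Finset.card_powersetCard, Finset.card_univ, Fintype.card_fin]

lemma choose_mul_choose_le (a b m j : ℕ) :
    a.choose b * m.choose j ≤ (a + m).choose (b + j) := by
  rw [Nat.add_choose_eq]
  exact Finset.single_le_sum (f := fun ij : ℕ × ℕ => a.choose ij.1 * m.choose ij.2)
    (fun _ _ => Nat.zero_le _) (Finset.HasAntidiagonal.mem_antidiagonal.2 (rfl : (b, j).1 + (b, j).2 = b + j))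

/-- Choosing 2 points in each of `q` blocks of 13 gives `78 ^ q` subsets. The block size 13 matches
the separation ratio 4/13, slightly below `1/√10`. -/
lemma pow_le_choose_thirteen_mul (q : ℕ) : 78 ^ q ≤ (13 * q).choose (2 * q) := by
  induction q with
  | zero => simp
  | succ q ih =>
    have h := choose_mul_choose_le (13 * q) (2 * q) 13 2
    have h2 : Nat.choose 13 2 = 78 := by decide
    rw [h2] at h
    calc 78 ^ (q + 1) = 78 ^ q * 78 := pow_succ _ _
      _ ≤ _ := Nat.mul_le_mul_right _ ih
      _ ≤ _ := h

/-- A single term of the binomial expansion; `z` stays free to be tuned against the factor 78. -/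
lemma choose_mul_pow_le {z : ℝ} (hz : 0 ≤ z) (k j : ℕ) : (k.choose j : ℝ) * z ^ j ≤ (1 + z) ^ k := by
  rcases lt_or_ge k j with h | h
  · rw [Nat.choose_eq_zero_of_lt h]
    simp only [Nat.cast_zero, zero_mul]
    positivity
  · rw [add_comm, add_pow]
    have := Finset.single_le_sum (f := fun m => z ^ m * 1 ^ (k - m) * (k.choose m : ℝ))
      (s := Finset.range (k + 1)) (fun _ _ => by positivity) (Finset.mem_range.2 (by omega : j < k + 1))
    simpa [mul_comm] using this

lemma pow_le_two_rpow (k : ℕ) : (1.68 : ℝ) ^ k ≤ (2 : ℝ) ^ (3 * (k : ℝ) / 4) := by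
  have h : (1.68 : ℝ) ≤ (2 : ℝ) ^ (3 / 4 : ℝ) := by
    refine le_of_pow_le_pow_left₀ (n := 4) (by norm_num) (by positivity) ?_
    rw [← Real.rpow_natCast ((2 : ℝ) ^ (3 / 4 : ℝ)), ← Real.rpow_mul (by norm_num)]
    norm_num
  calc (1.68 : ℝ) ^ k ≤ ((2 : ℝ) ^ (3 / 4 : ℝ)) ^ k := by gcongr
    _ = _ := by
      rw [← Real.rpow_natCast ((2 : ℝ) ^ (3 / 4 : ℝ)), ← Real.rpow_mul (by norm_num)]
      congr 1; ring

/-- A constant-weight code of weight `d` and minimal distance above `4 (d - 1) / 13`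
has `O (2 ^ (3 k / 4))` words. -/
lemma card_le_of_constant_weight {k d : ℕ} (A : Finset (SellerSet k)) (hd : 1 ≤ d)
    (hA : ∀ x ∈ A, x.card = d)
    (hsep : ∀ x ∈ A, ∀ y ∈ A, x ≠ y → 4 * (d - 1) < 13 * (symmDiff x y).card) :
    (A.card : ℝ) ≤ 160 * (2 : ℝ) ^ (3 * (k : ℝ) / 4) := by
  -- It is `d - 1`, not `d`, that is divided by 13: the separation then exceeds `4 q`, as the
  -- packing bound with `r = 2 q` requires.
  obtain ⟨q, s, hs, hs1, rfl⟩ : ∃ q s, s ≤ 13 ∧ 1 ≤ s ∧ d = 13 * q + s :=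
    ⟨(d - 1) / 13, (d - 1) % 13 + 1, by omega, by omega, by omega⟩
  have h1 := card_mul_choose_le_of_separated (r := 2 * q) A (by omega) hA fun x hx y hy hxy => by
    have := hsep x hx y hy hxy
    omega
  have h2 : 78 ^ q ≤ (13 * q + s).choose (2 * q) :=
    (pow_le_choose_thirteen_mul q).trans (Nat.choose_le_choose _ (by omega))
  have h3 : A.card * 78 ^ q ≤ k.choose (11 * q + s) := by
    refine (Nat.mul_le_mul_left _ h2).trans ?_
    have : 13 * q + s - 2 * q = 11 * q + s := by omega
    rwa [this] at h1
  have h3' : (A.card : ℝ) * 78 ^ q ≤ (k.choose (11 * q + s) : ℝ) := by exact_mod_cast h3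
  -- The value 0.68 meets two demands: `78 * 0.68 ^ 11 ≥ 1` removes the dependence on `q`, and `1.68
  -- ^ 4 ≤ 2 ^ 3` gives the exponent 3/4. The leftover `0.68 ^ s` costs the factor 160.
  have h4 := choose_mul_pow_le (z := 0.68) (by norm_num) k (11 * q + s)
  have h5 : (1 : ℝ) ≤ 78 ^ q * (0.68 ^ (11 * q)) := by
    rw [pow_mul, ← mul_pow]
    exact one_le_pow₀ (by norm_num)
  have h6 : (1 / 160 : ℝ) ≤ 0.68 ^ s :=
    le_trans (by norm_num) (pow_le_pow_of_le_one (by norm_num) (by norm_num) hs : (0.68 : ℝ) ^ 13 ≤ _)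
  have h7 : (A.card : ℝ) * (1 / 160) ≤ 1.68 ^ k := by
    calc (A.card : ℝ) * (1 / 160) ≤ A.card * 0.68 ^ s := by gcongr
      _ ≤ A.card * 0.68 ^ s * (78 ^ q * (0.68 ^ (11 * q))) :=
        le_mul_of_one_le_right (by positivity) h5
      _ = (A.card * 78 ^ q) * 0.68 ^ (11 * q + s) := by ring
      _ ≤ (k.choose (11 * q + s) : ℝ) * 0.68 ^ (11 * q + s) := by gcongr
      _ ≤ _ := h4
      _ = _ := by norm_num
  have := pow_le_two_rpow k
  linarith

/-- The same bound for a code on a Hamming sphere around an arbitrary centre. -/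
lemma card_le_of_sphere {k d : ℕ} (γd : SellerSet k) (A : Finset (SellerSet k)) (hd : 1 ≤ d)
    (hA : ∀ x ∈ A, (symmDiff x γd).card = d)
    (hsep : ∀ x ∈ A, ∀ y ∈ A, x ≠ y → 4 * (d - 1) < 13 * (symmDiff x y).card) :
    (A.card : ℝ) ≤ 160 * (2 : ℝ) ^ (3 * (k : ℝ) / 4) := by
  -- Translation by `γd` is a Hamming isometry that moves the centre of the sphere to the empty set.
  have hinj : Function.Injective fun x : SellerSet k => symmDiff x γd := symmDiff_left_injective γd
  rw [← Finset.card_image_of_injective A hinj]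
  refine card_le_of_constant_weight (d := d) _ hd ?_ ?_
  · simpa using hA
  · simp only [Finset.mem_image]
    rintro _ ⟨x, hx, rfl⟩ _ ⟨y, hy, rfl⟩ hxy
    rw [symmDiff_symmDiff_symmDiff_comm, symmDiff_self, symmDiff_bot]
    exact hsep x hx y hy fun h => hxy (by rw [h])

/-! ### Hamming distance and the unit ball. -/

section Hamming

variable {k : ℕ}

lemma hammingFrac_le_one (γ γ' : SellerSet k) : hammingFrac γ γ' ≤ 1 := by
  unfold hammingFrac
  refine div_le_one_of_le₀ ?_ (by positivity)
  exact_mod_cast (Finset.card_le_univ _).trans (by simp)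

lemma hammingFrac_self (γ : SellerSet k) : hammingFrac γ γ = 0 := by
  simp [hammingFrac]

lemma hammingFrac_comm (γ γ' : SellerSet k) : hammingFrac γ γ' = hammingFrac γ' γ := by
  simp [hammingFrac, symmDiff_comm]

/-- A unit Hamming ball has `k + 1` elements. -/
lemma card_unit_ball_le (γd : SellerSet k) :
    (Finset.univ.filter fun γ : SellerSet k => (symmDiff γ γd).card ≤ 1).card ≤ k + 1 := by
  have hinj : Function.Injective fun x : SellerSet k => symmDiff x γd := symmDiff_left_injective γd
  rw [← Finset.card_image_of_injective _ hinj]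
  refine (Finset.card_le_card (t := Finset.powersetCard 0 Finset.univ ∪
    Finset.powersetCard 1 Finset.univ) ?_).trans ((Finset.card_union_le _ _).trans ?_)
  · simp only [Finset.subset_iff, Finset.mem_image, Finset.mem_filter, Finset.mem_univ, true_and,
      Finset.mem_union, Finset.mem_powersetCard]
    rintro _ ⟨x, hx, rfl⟩
    have hx' : (symmDiff x γd).card = 0 ∨ (symmDiff x γd).card = 1 := by omega
    simpa using hx'
  · simp [add_comm]

end Hamming

/-! ### Order counts and confidence radii. -/

section Counting

variable {k : ℕ} (order : ℕ → SellerSet k)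

lemma pullCount_zero (γ : SellerSet k) : pullCount order 0 γ = 0 := by simp [pullCount]

lemma pullCount_succ (t : ℕ) (γ : SellerSet k) :
    pullCount order (t + 1) γ = pullCount order t γ + if order t = γ then 1 else 0 := by
  unfold pullCount
  rw [Finset.range_add_one, Finset.filter_insert]
  split_ifs with h
  · rw [Finset.card_insert_of_notMem (by simp)]
  · simp

lemma pullCount_mono (γ : SellerSet k) : Monotone fun t => pullCount order t γ :=
  monotone_nat_of_le_succ fun t => by simp [pullCount_succ]

lemma pullCount_le (t : ℕ) (γ : SellerSet k) : pullCount order t γ ≤ t :=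
  (Finset.card_filter_le _ _).trans (by simp)

lemma confRadius_nonneg (T t : ℕ) (γ : SellerSet k) : 0 ≤ confRadius T order t γ :=
  Real.sqrt_nonneg _

lemma confRadius_sq (T t : ℕ) (γ : SellerSet k) :
    confRadius T order t γ ^ 2 = 12 * Real.log T / ((pullCount order t γ : ℝ) + 1) :=
  Real.sq_sqrt (div_nonneg (mul_nonneg (by norm_num) (Real.log_natCast_nonneg T)) (by positivity))

lemma sum_order_eq (g : SellerSet k → ℝ) (T : ℕ) :
    ∑ t ∈ Finset.range T, g (order t) = ∑ γ, (pullCount order T γ : ℝ) * g γ := by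
  rw [← Finset.sum_fiberwise (Finset.range T) order]
  refine Finset.sum_congr rfl fun γ _ => ?_
  rw [Finset.sum_congr rfl (g := fun _ => g γ), Finset.sum_const, nsmul_eq_mul]
  · rfl
  · intro t ht
    rw [(Finset.mem_filter.1 ht).2]

end Counting

/-! ### Deterministic analysis of a path with correct confidence intervals. -/

namespace DataMarket

variable {n k : ℕ} {X : Type*} [MeasurableSpace X]

/-- Expected effective utility lost by ordering `γ` instead of `γd`. -/
noncomputable def gap (M : DataMarket n k X) (α : ℝ) (i : Fin n) (γd γ : SellerSet k) : ℝ :=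
  M.meanEffUtility α i γd - M.meanEffUtility α i γ

variable {M : DataMarket n k X} {α lam : ℝ} {T : ℕ} {i : Fin n} {γd : SellerSet k}

lemma Closeness.gap_le (h : M.Closeness α lam i γd) (γ : SellerSet k) :
    M.gap α i γd γ ≤ lam * hammingFrac γ γd := (h γ).2

lemma Closeness.le_gap (h : M.Closeness α lam i γd) (γ : SellerSet k) :
    lam * (((symmDiff γ γd).card : ℝ) - 1) / k ≤ M.gap α i γd γ := by
  refine le_of_eq_of_le ?_ (h γ).1
  unfold hammingFrac; ring

lemma Closeness.gap_le_lam (h : M.Closeness α lam i γd) (hlam : 0 < lam) (γ : SellerSet k) :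
    M.gap α i γd γ ≤ lam :=
  (h.gap_le γ).trans (mul_le_of_le_one_right hlam.le (hammingFrac_le_one _ _))

lemma Closeness.gap_nonneg (h : M.Closeness α lam i γd) (hlam : 0 < lam) (γ : SellerSet k) :
    0 ≤ M.gap α i γd γ := by
  rcases eq_or_ne γ γd with rfl | hne
  · simp [gap]
  · refine le_trans ?_ (h.le_gap γ)
    have h1 : 1 ≤ (symmDiff γ γd).card := by
      rw [Nat.one_le_iff_ne_zero, Ne, Finset.card_eq_zero]
      exact fun h => hne (symmDiff_eq_bot.1 h)
    have h2 : (0 : ℝ) ≤ ((symmDiff γ γd).card : ℝ) - 1 := by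
      rw [sub_nonneg]; exact_mod_cast h1
    positivity

namespace IsZoomingPath

variable {x : ℕ → X} {active : ℕ → Finset (SellerSet k)} {order : ℕ → SellerSet k}

lemma active_subset_succ (h : M.IsZoomingPath α lam T i x active order) {t : ℕ} (ht : t < T) :
    active t ⊆ active (t + 1) := by
  by_cases hc : ∃ γ, ¬ IsCovered lam T order t (active t) γ
  · obtain ⟨γ, -, hγ⟩ := h.activate t ht hc
    rw [hγ]
    exact Finset.subset_insert _ _
  · push Not at hc
    rw [h.keep t ht hc]

lemma mem_active_of_pullCount (h : M.IsZoomingPath α lam T i x active order) {t : ℕ} (ht : t ≤ T)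
    {γ : SellerSet k} (hγ : pullCount order t γ ≠ 0) : γ ∈ active t := by
  induction t with
  | zero => simp [pullCount_zero] at hγ
  | succ t ih =>
    rw [pullCount_succ] at hγ
    split_ifs at hγ with ho
    · exact ho ▸ h.order_mem t ht
    · exact h.active_subset_succ ht (ih (by omega) (by omega))

lemma isCovered_of_mem {t : ℕ} {A : Finset (SellerSet k)} {γ : SellerSet k}
    (hγ : γ ∈ A) : IsCovered lam T order t A γ :=
  ⟨γ, hγ, by rw [hammingFrac_self, mul_zero]; exact confRadius_nonneg _ _ _ _⟩

/-- After the activation step every seller set is covered: a new active set has not been ordered,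
and its confidence radius exceeds the diameter. -/
lemma isCovered_succ (h : M.IsZoomingPath α lam T i x active order) (hlam : 0 < lam)
    (hT : lam ^ 2 ≤ 12 * Real.log T) {t : ℕ} (ht : t < T) (γ : SellerSet k) :
    IsCovered lam T order t (active (t + 1)) γ := by
  by_cases hc : ∃ γ, ¬ IsCovered lam T order t (active t) γ
  · obtain ⟨γ', hun, hγ'⟩ := h.activate t ht hc
    have hn : pullCount order t γ' = 0 := by
      by_contra hne
      exact hun (isCovered_of_mem (h.mem_active_of_pullCount ht.le hne))
    refine ⟨γ', by simp [hγ'], ?_⟩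
    calc lam * hammingFrac γ γ' ≤ lam := mul_le_of_le_one_right hlam.le (hammingFrac_le_one _ _)
      _ ≤ confRadius T order t γ' := by
        refine Real.le_sqrt_of_sq_le ?_
        simpa [hn] using hT
  · push Not at hc
    rw [h.keep t ht hc]
    exact hc γ

/-- If all confidence intervals are correct, the gap of an order is at most three radii. -/
lemma gap_order_le (h : M.IsZoomingPath α lam T i x active order) (hlam : 0 < lam)
    (hT : lam ^ 2 ≤ 12 * Real.log T) (hcl : M.Closeness α lam i γd)
    (hclean : ∀ t < T, ∀ γ,
      |M.empMean α i x order t γ - M.meanEffUtility α i γ| ≤ confRadius T order t γ)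
    {t : ℕ} (ht : t < T) :
    M.gap α i γd (order t) ≤ 3 * confRadius T order t (order t) := by
  -- With `u` the mean and `c` the radius, `u(γd) ≤ u(γ') + c(γ') ≤ ucb(γ') ≤ ucb(order t) ≤ u(order
  -- t) + 3 c(order t)`.
  obtain ⟨γ', hγ', hcov⟩ := h.isCovered_succ hlam hT ht γd
  have h1 := h.order_max t ht γ' hγ'
  have h2 := abs_le.1 (hclean t ht γ')
  have h3 := abs_le.1 (hclean t ht (order t))
  have h4 := hcl.gap_le γ'
  rw [hammingFrac_comm] at h4
  unfold ucb at h1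
  unfold gap at *
  linarith [h2.1, h2.2, h3.1, h3.2]

/-- The three-radius bound is read off at the latest order of `γ`. The `+ 1` in the radius makes its
denominator the count after that order, so nothing is lost; 108 is `9 * 12`. -/
lemma pullCount_mul_gap_sq_le (h : M.IsZoomingPath α lam T i x active order) (hlam : 0 < lam)
    (hT : lam ^ 2 ≤ 12 * Real.log T) (hcl : M.Closeness α lam i γd)
    (hclean : ∀ t < T, ∀ γ,
      |M.empMean α i x order t γ - M.meanEffUtility α i γ| ≤ confRadius T order t γ)
    {t : ℕ} (ht : t ≤ T) (γ : SellerSet k) :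
    (pullCount order t γ : ℝ) * M.gap α i γd γ ^ 2 ≤ 108 * Real.log T := by
  induction t with
  | zero =>
    rw [pullCount_zero, Nat.cast_zero, zero_mul]
    have := Real.log_natCast_nonneg T
    positivity
  | succ t ih =>
    rw [pullCount_succ]
    split_ifs with ho
    · have h1 := h.gap_order_le hlam hT hcl hclean ht
      rw [ho] at h1
      have h2 := pow_le_pow_left₀ (hcl.gap_nonneg hlam γ) h1 2
      rw [mul_pow, confRadius_sq, ← mul_div_assoc, le_div_iff₀ (by positivity)] at h2
      push_cast
      linarith
    · simpa using ih (by omega)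

/-- Unlike the three-radius bound, this holds at every time, also when `γ` is not being ordered.
Adding `gap² ≤ lam² ≤ 12 log T` to the count bound 108 gives `120 = 10 * 12`. -/
lemma gap_sq_le (h : M.IsZoomingPath α lam T i x active order) (hlam : 0 < lam)
    (hT : lam ^ 2 ≤ 12 * Real.log T) (hcl : M.Closeness α lam i γd)
    (hclean : ∀ t < T, ∀ γ,
      |M.empMean α i x order t γ - M.meanEffUtility α i γ| ≤ confRadius T order t γ)
    {t : ℕ} (ht : t ≤ T) (γ : SellerSet k) :
    M.gap α i γd γ ^ 2 ≤ 10 * confRadius T order t γ ^ 2 := by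
  rw [confRadius_sq, ← mul_div_assoc, le_div_iff₀ (by positivity)]
  have h1 := h.pullCount_mul_gap_sq_le hlam hT hcl hclean ht γ
  have h2 := pow_le_pow_left₀ (hcl.gap_nonneg hlam γ) (hcl.gap_le_lam hlam γ) 2
  linarith

/-- Active sets are separated on the scale of their gaps. -/
lemma separated (h : M.IsZoomingPath α lam T i x active order) (hlam : 0 < lam)
    (hT : lam ^ 2 ≤ 12 * Real.log T) (hcl : M.Closeness α lam i γd)
    (hclean : ∀ t < T, ∀ γ,
      |M.empMean α i x order t γ - M.meanEffUtility α i γ| ≤ confRadius T order t γ)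
    {t : ℕ} (ht : t ≤ T) {γ γ' : SellerSet k} (hγ : γ ∈ active t) (hγ' : γ' ∈ active t)
    (hne : γ ≠ γ') :
    M.gap α i γd γ ^ 2 < 10 * (lam * hammingFrac γ γ') ^ 2 ∨
      M.gap α i γd γ' ^ 2 < 10 * (lam * hammingFrac γ γ') ^ 2 := by
  induction t with
  | zero =>
    obtain ⟨γ₀, h₀⟩ := h.init
    rw [h₀, Finset.mem_singleton] at hγ hγ'
    exact absurd (hγ.trans hγ'.symm) hne
  | succ t ih =>
    -- Only the earlier activated set of a pair has its gap controlled, hence the disjunction in the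
    -- conclusion.
    have key : ∀ γ₁ γ₂, ¬ IsCovered lam T order t (active t) γ₁ → γ₂ ∈ active t →
        M.gap α i γd γ₂ ^ 2 < 10 * (lam * hammingFrac γ₁ γ₂) ^ 2 := by
      intro γ₁ γ₂ h1 h2
      have h3 : confRadius T order t γ₂ < lam * hammingFrac γ₁ γ₂ :=
        lt_of_not_ge fun hle => h1 ⟨γ₂, h2, hle⟩
      have h4 := pow_lt_pow_left₀ h3 (confRadius_nonneg _ _ _ _) two_ne_zero
      linarith [h.gap_sq_le hlam hT hcl hclean (by omega : t ≤ T) γ₂]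
    by_cases hc : ∃ γ, ¬ IsCovered lam T order t (active t) γ
    · obtain ⟨γ₁, hun, hins⟩ := h.activate t ht hc
      rw [hins, Finset.mem_insert] at hγ hγ'
      rcases hγ with rfl | hγ <;> rcases hγ' with rfl | hγ'
      · exact absurd rfl hne
      · exact Or.inr (key _ _ hun hγ')
      · rw [hammingFrac_comm]
        exact Or.inl (key _ _ hun hγ)
      · exact ih (by omega) hγ hγ'
    · push Not at hc
      rw [h.keep t ht hc] at hγ hγ'
      exact ih (by omega) hγ hγ'

/-- Number of active sets that differ from `γd` in at least two sellers. -/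
lemma card_far_active_le (h : M.IsZoomingPath α lam T i x active order) (hlam : 0 < lam)
    (hk : 1 ≤ k) (hT : lam ^ 2 ≤ 12 * Real.log T) (hcl : M.Closeness α lam i γd)
    (hclean : ∀ t < T, ∀ γ,
      |M.empMean α i x order t γ - M.meanEffUtility α i γ| ≤ confRadius T order t γ) :
    (((active T).filter fun γ => ¬ (symmDiff γ γd).card ≤ 1).card : ℝ) ≤
      k * (160 * (2 : ℝ) ^ (3 * (k : ℝ) / 4)) := by
  have hk' : (0 : ℝ) < k := by exact_mod_cast hk
  have hmaps : Set.MapsTo (fun γ : SellerSet k => (symmDiff γ γd).card)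
      ((active T).filter fun γ => ¬ (symmDiff γ γd).card ≤ 1 : Finset (SellerSet k))
      (Finset.Icc 1 k : Finset ℕ) := by
    intro γ hγ
    have h1 := (Finset.mem_filter.1 hγ).2
    rw [Finset.coe_Icc, Set.mem_Icc]
    exact ⟨by dsimp only; omega, (Finset.card_le_univ _).trans (by simp)⟩
  rw [Finset.card_eq_sum_card_fiberwise hmaps, Nat.cast_sum]
  refine (Finset.sum_le_card_nsmul _ _ (160 * (2 : ℝ) ^ (3 * (k : ℝ) / 4)) fun d hd => ?_).trans ?_
  · rw [Finset.mem_Icc] at hd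
    refine card_le_of_sphere γd _ hd.1 (fun γ hγ => (Finset.mem_filter.1 hγ).2) ?_
    intro γ hγ γ' hγ' hne
    simp only [Finset.mem_filter] at hγ hγ'
    -- Both sets lie on the same sphere, so it does not matter whose gap is controlled. The ratio
    -- 4/13 works because `16 * 10 ≤ 13 ^ 2`.
    have hlow : ∀ γ₁ : SellerSet k, (symmDiff γ₁ γd).card = d →
        M.gap α i γd γ₁ ^ 2 < 10 * (lam * hammingFrac γ γ') ^ 2 →
        4 * (d - 1) < 13 * (symmDiff γ γ').card := by
      intro γ₁ h1 h2
      have h3 := hcl.le_gap γ₁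
      rw [h1] at h3
      have hd1 : (0 : ℝ) ≤ (d : ℝ) - 1 := by rw [sub_nonneg]; exact_mod_cast hd.1
      have h4 := pow_le_pow_left₀ (by positivity) h3 2
      have h5 := h4.trans_lt h2
      unfold hammingFrac at h5
      have h6 : ((d : ℝ) - 1) ^ 2 < 10 * ((symmDiff γ γ').card : ℝ) ^ 2 := by
        have e1 : (lam * ((d : ℝ) - 1) / k) ^ 2 = (lam / k) ^ 2 * ((d : ℝ) - 1) ^ 2 := by ring
        have e2 : 10 * (lam * (((symmDiff γ γ').card : ℝ) / k)) ^ 2 =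
            (lam / k) ^ 2 * (10 * ((symmDiff γ γ').card : ℝ) ^ 2) := by ring
        rw [e1, e2] at h5
        exact lt_of_mul_lt_mul_left h5 (by positivity)
      have h7 : 4 * ((d : ℝ) - 1) < 13 * ((symmDiff γ γ').card : ℝ) := by
        refine lt_of_pow_lt_pow_left₀ 2 (by positivity) ?_
        have : (0 : ℝ) ≤ ((symmDiff γ γ').card : ℝ) ^ 2 := by positivity
        nlinarith
      rw [← Nat.cast_one, ← Nat.cast_sub hd.1] at h7
      exact_mod_cast h7
    rcases h.separated hlam hT hcl hclean le_rfl hγ.1.1 hγ'.1.1 hne with h1 | h1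
    · exact hlow γ hγ.2 h1
    · exact hlow γ' hγ'.2 h1
  · simp

/-- Regret of one realization with correct confidence intervals. -/
lemma sum_gap_le (h : M.IsZoomingPath α lam T i x active order) (hlam : 0 < lam)
    (hk : 1 ≤ k) (hT : lam ^ 2 ≤ 12 * Real.log T) (hcl : M.Closeness α lam i γd)
    (hclean : ∀ t < T, ∀ γ,
      |M.empMean α i x order t γ - M.meanEffUtility α i γ| ≤ confRadius T order t γ) :
    ∑ t ∈ Finset.range T, M.gap α i γd (order t) ≤
      (k + 1) * (11 * Real.sqrt (T * Real.log T)) +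
        k * (160 * (2 : ℝ) ^ (3 * (k : ℝ) / 4)) * (108 * Real.log T * k / lam) := by
  have hk' : (0 : ℝ) < k := by exact_mod_cast hk
  have hL := Real.log_natCast_nonneg T
  have hN := fun γ => h.pullCount_mul_gap_sq_le hlam hT hcl hclean le_rfl γ
  rw [sum_order_eq, ← Finset.sum_filter_add_sum_filter_not Finset.univ
    (fun γ : SellerSet k => (symmDiff γ γd).card ≤ 1)]
  refine add_le_add ?_ ?_
  · refine (Finset.sum_le_card_nsmul _ _ (11 * Real.sqrt (T * Real.log T)) fun γ _ => ?_).trans ?_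
    -- Squared, this is `N² Δ² = N (N Δ²) ≤ T * 108 log T`, and `108 ≤ 11 ^ 2`.
    · refine le_of_pow_le_pow_left₀ two_ne_zero (by positivity) ?_
      rw [mul_pow, mul_pow, Real.sq_sqrt (by positivity)]
      have h1 : (pullCount order T γ : ℝ) ≤ T := by exact_mod_cast pullCount_le order T γ
      calc (pullCount order T γ : ℝ) ^ 2 * M.gap α i γd γ ^ 2
          = pullCount order T γ * (pullCount order T γ * M.gap α i γd γ ^ 2) := by ring
        _ ≤ T * (108 * Real.log T) := by
          refine mul_le_mul h1 (hN γ) (by positivity) (by positivity)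
        _ ≤ 11 ^ 2 * (T * Real.log T) := by
          have : (0 : ℝ) ≤ T * Real.log T := by positivity
          linarith
    · rw [nsmul_eq_mul]
      refine mul_le_mul_of_nonneg_right ?_ (by positivity)
      exact_mod_cast card_unit_ball_le γd
  · have hsub : (active T).filter (fun γ => ¬ (symmDiff γ γd).card ≤ 1) ⊆
        Finset.univ.filter (fun γ : SellerSet k => ¬ (symmDiff γ γd).card ≤ 1) :=
      Finset.filter_subset_filter _ (Finset.subset_univ _)
    rw [← Finset.sum_subset hsub]
    · refine (Finset.sum_le_card_nsmul _ _ (108 * Real.log T * k / lam) fun γ hγ => ?_).trans ?_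
      · have h2 : (2 : ℝ) ≤ (symmDiff γ γd).card := by
          have := (Finset.mem_filter.1 hγ).2
          exact_mod_cast (by omega : 2 ≤ (symmDiff γ γd).card)
        have h3 : lam / k ≤ M.gap α i γd γ := by
          refine le_trans ?_ (hcl.le_gap γ)
          gcongr
          nlinarith
        have h4 : 0 < lam / k := by positivity
        have h5 : (pullCount order T γ : ℝ) * M.gap α i γd γ * (lam / k) ≤ 108 * Real.log T := by
          refine le_trans ?_ (hN γ)
          rw [pow_two, ← mul_assoc]
          gcongr
          exact mul_nonneg (by positivity) (h4.le.trans h3)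
        rw [← le_div_iff₀ h4] at h5
        refine h5.trans (le_of_eq ?_)
        field_simp
      · rw [nsmul_eq_mul]
        exact mul_le_mul_of_nonneg_right (h.card_far_active_le hlam hk hT hcl hclean)
          (by positivity)
    · intro γ h1 h2
      have h3 : γ ∉ active T := fun h3 => h2 (Finset.mem_filter.2 ⟨h3, (Finset.mem_filter.1 h1).2⟩)
      have h4 : pullCount order T γ = 0 := by
        by_contra h5
        exact h3 (h.mem_active_of_pullCount le_rfl h5)
      rw [h4, Nat.cast_zero, zero_mul]

end IsZoomingPath

end DataMarket

/-! ### The first orders of a fixed seller set. -/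

section Counting

variable {k : ℕ} (order : ℕ → SellerSet k)

/-- The rounds before `t` with one of the first `m` orders of `γ`. -/
lemma card_first_pulls (t m : ℕ) (γ : SellerSet k) :
    ((Finset.range t).filter fun r => order r = γ ∧ pullCount order r γ < m).card =
      min (pullCount order t γ) m := by
  induction t with
  | zero => simp [pullCount_zero]
  | succ t ih =>
    rw [Finset.range_add_one, Finset.filter_insert, pullCount_succ]
    by_cases h : order t = γ
    · by_cases h' : pullCount order t γ < m
      · rw [if_pos ⟨h, h'⟩, Finset.card_insert_of_notMem (by simp), ih, if_pos h]
        omega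
      · rw [if_neg (fun hh => h' hh.2), ih, if_pos h]
        omega
    · rw [if_neg (fun hh => h hh.1), ih, if_neg h, add_zero]

/-- This replaces the random sample behind an empirical mean by the first `m` orders, with `m` the
current count; a union bound over deterministic `m` then applies. -/
lemma filter_first_pulls {t T : ℕ} (ht : t ≤ T) (γ : SellerSet k) :
    ((Finset.range T).filter fun r => order r = γ ∧ pullCount order r γ < pullCount order t γ) =
      (Finset.range t).filter fun r => order r = γ := by
  ext r
  simp only [Finset.mem_filter, Finset.mem_range]
  constructor
  · rintro ⟨-, ho, hc⟩
    exact ⟨lt_of_not_ge fun h => hc.not_ge (pullCount_mono order γ h), ho⟩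
  · rintro ⟨hr, ho⟩
    refine ⟨by omega, ho, ?_⟩
    have h := pullCount_mono order γ (Nat.succ_le_of_lt hr)
    simp only [Nat.succ_eq_add_one, pullCount_succ, if_pos ho] at h
    omega

end Counting

/-! ### Concentration for predictably selected outcomes. -/

namespace DataMarket

variable {n k : ℕ} {X : Type*} [MeasurableSpace X] {M : DataMarket n k X} {α lam : ℝ} {i : Fin n}

lemma measurable_effUtility (M : DataMarket n k X) (α : ℝ) (i : Fin n) (γ : SellerSet k) :
    Measurable (M.effUtility α i γ) := by
  unfold effUtility gain
  exact ((M.perf_measurable i γ).sub_const _).sub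
    ((Finset.measurable_fun_sum _ fun j _ => M.ext_measurable j i γ).const_mul _)

lemma effUtility_mem (M : DataMarket n k X) (hα : α ∈ Set.Icc (0 : ℝ) 1) (i : Fin n)
    (γ : SellerSet k) (x : X) :
    M.effUtility α i γ x ∈ Set.Icc (-M.cost γ - 1) (1 - M.cost γ) := by
  have h1 := M.perf_mem i γ x
  have h2 := M.ext_sum_mem i γ x
  have h3 := mul_nonneg hα.1 h2.1
  have h4 := mul_le_one₀ hα.2 h2.1 h2.2
  unfold effUtility gain
  constructor <;> linarith [h1.1, h1.2]

lemma abs_effUtility_le (M : DataMarket n k X) (hα : α ∈ Set.Icc (0 : ℝ) 1) (i : Fin n)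
    (γ : SellerSet k) (x : X) : |M.effUtility α i γ x| ≤ 2 := by
  have h1 := M.effUtility_mem hα i γ x
  have h2 := M.cost_mem γ
  exact abs_le.2 ⟨by linarith [h1.1, h2.2], by linarith [h1.2, h2.1]⟩

lemma integrable_effUtility (M : DataMarket n k X) (hα : α ∈ Set.Icc (0 : ℝ) 1) (i : Fin n)
    (γ : SellerSet k) : Integrable (M.effUtility α i γ) M.law := by
  have := M.isProb
  exact Integrable.of_bound (M.measurable_effUtility α i γ).aestronglyMeasurable 2
    (Filter.Eventually.of_forall fun x => M.abs_effUtility_le hα i γ x)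

lemma abs_meanEffUtility_le (M : DataMarket n k X) (hα : α ∈ Set.Icc (0 : ℝ) 1) (i : Fin n)
    (γ : SellerSet k) : |M.meanEffUtility α i γ| ≤ 2 := by
  have := M.isProb
  have h := norm_integral_le_of_norm_le_const (μ := M.law) (f := M.effUtility α i γ) (C := 2)
    (Filter.Eventually.of_forall fun x => M.abs_effUtility_le hα i γ x)
  simpa [meanEffUtility] using h

/-- Hoeffding's lemma for the effective utility, whose range has length two. -/
lemma hasSubgaussianMGF_effUtility (M : DataMarket n k X) (hα : α ∈ Set.Icc (0 : ℝ) 1) (i : Fin n)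
    (γ : SellerSet k) :
    HasSubgaussianMGF (fun x => M.effUtility α i γ x - M.meanEffUtility α i γ) 1 M.law := by
  have := M.isProb
  have h := hasSubgaussianMGF_of_mem_Icc (μ := M.law)
    (M.measurable_effUtility α i γ).aemeasurable
    (Filter.Eventually.of_forall fun x => M.effUtility_mem hα i γ x)
  convert! h using 1
  have e : 1 - M.cost γ - (-M.cost γ - 1) = 2 := by ring
  rw [e]
  ext
  simp

variable {Ω : Type*} {mΩ : MeasurableSpace Ω} {P : Measure Ω} {ℱ : Filtration ℕ mΩ} {ξ : ℕ → Ω → X}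

namespace IsRepeatedMarket

lemma measurable (hM : M.IsRepeatedMarket P ℱ ξ) (t : ℕ) : Measurable (ξ t) :=
  (hM.adapted t).mono (ℱ.le _) le_rfl

lemma integral_mul_comp (hM : M.IsRepeatedMarket P ℱ ξ) {t : ℕ} {f : Ω → ℝ}
    (hf : Measurable[ℱ t] f) {g : X → ℝ} (hg : Measurable g) :
    ∫ ω, f ω * g (ξ t ω) ∂P = (∫ ω, f ω ∂P) * ∫ x, g x ∂M.law := by
  have hξ := hM.measurable t
  have hind : IndepFun f (fun ω => g (ξ t ω)) P := by
    rw [IndepFun_iff_Indep]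
    refine indep_of_indep_of_le_left (indep_of_indep_of_le_right (hM.indep t).symm ?_)
      hf.comap_le
    exact (hg.comp (comap_measurable (ξ t))).comap_le
  rw [hind.integral_fun_mul_eq_mul_integral (hf.mono (ℱ.le t) le_rfl).aestronglyMeasurable
    (hg.comp hξ).aestronglyMeasurable, ← hM.map_eq t,
    integral_map hξ.aemeasurable hg.aestronglyMeasurable]

lemma measurable_sum_indicator (hM : M.IsRepeatedMarket P ℱ ξ) {T : ℕ} {A : ℕ → Set Ω}
    (hA : ∀ t < T, MeasurableSet[ℱ t] (A t)) {h : X → ℝ} (hh : Measurable h) {t : ℕ} (ht : t ≤ T) :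
    Measurable[ℱ t] fun ω =>
      ∑ r ∈ Finset.range t, (A r).indicator (fun ω => h (ξ r ω)) ω := by
  refine Finset.measurable_fun_sum _ fun r hr => ?_
  rw [Finset.mem_range] at hr
  refine Measurable.indicator ?_ (ℱ.mono hr.le _ (hA r (by omega)))
  exact hh.comp ((hM.adapted r).mono (ℱ.mono hr) le_rfl)

/-- The exponential process of a predictable selection of outcomes is a supermartingale. -/
lemma integral_exp_sum_indicator_le [IsProbabilityMeasure P] (hM : M.IsRepeatedMarket P ℱ ξ) {T : ℕ}
    {A : ℕ → Set Ω} (hA : ∀ t < T, MeasurableSet[ℱ t] (A t)) {h : X → ℝ} (hh : Measurable h)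
    {B : ℝ} (hB : ∀ x, |h x| ≤ B) (hexp : ∫ x, Real.exp (h x) ∂M.law ≤ 1) {t : ℕ} (ht : t ≤ T) :
    Integrable (fun ω =>
        Real.exp (∑ r ∈ Finset.range t, (A r).indicator (fun ω => h (ξ r ω)) ω)) P ∧
      ∫ ω, Real.exp (∑ r ∈ Finset.range t, (A r).indicator (fun ω => h (ξ r ω)) ω) ∂P ≤ 1 := by
  have hint : ∀ t ≤ T, Integrable (fun ω =>
      Real.exp (∑ r ∈ Finset.range t, (A r).indicator (fun ω => h (ξ r ω)) ω)) P := by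
    intro t ht
    refine Integrable.of_bound (((hM.measurable_sum_indicator hA hh ht).mono (ℱ.le t)
      le_rfl).exp).aestronglyMeasurable (Real.exp (t * B)) (Filter.Eventually.of_forall fun ω => ?_)
    rw [Real.norm_eq_abs, Real.abs_exp, Real.exp_le_exp]
    refine (Finset.sum_le_card_nsmul _ _ B fun r _ => ?_).trans (by simp)
    by_cases hω : ω ∈ A r
    · rw [Set.indicator_of_mem hω]
      exact (le_abs_self _).trans (hB _)
    · rw [Set.indicator_of_notMem hω]
      exact (abs_nonneg _).trans (hB (ξ r ω))
  refine ⟨hint t ht, ?_⟩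
  induction t with
  | zero => simp
  | succ t ih =>
    set Z : Ω → ℝ := fun ω =>
      Real.exp (∑ r ∈ Finset.range t, (A r).indicator (fun ω => h (ξ r ω)) ω) with hZ
    have hZm : Measurable[ℱ t] Z := (hM.measurable_sum_indicator hA hh (by omega)).exp
    have hAt := hA t (by omega)
    have hAt' := ℱ.le t _ hAt
    have hZi : Integrable Z P := hint t (by omega)
    have hZA : Measurable[ℱ t] ((A t).indicator Z) := hZm.indicator hAt
    -- Off `A t` the process does not move; on `A t` it gains a factor independent of the past with
    -- mean at most 1.
    have hsplit : (fun ω =>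
        Real.exp (∑ r ∈ Finset.range (t + 1), (A r).indicator (fun ω => h (ξ r ω)) ω)) =
        fun ω => (A t)ᶜ.indicator Z ω + (A t).indicator Z ω * Real.exp (h (ξ t ω)) := by
      funext ω
      rw [Finset.sum_range_succ, Real.exp_add]
      by_cases hω : ω ∈ A t
      · simp [hω, hZ]
      · simp [hω, hZ]
    have hi1 : Integrable ((A t)ᶜ.indicator Z) P := hZi.indicator hAt'.compl
    have hi2 : Integrable (fun ω => (A t).indicator Z ω * Real.exp (h (ξ t ω))) P := by
      have := (hint (t + 1) ht).sub hi1
      refine this.congr (Filter.Eventually.of_forall fun ω => ?_)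
      have h2 := congrFun hsplit ω
      simp only [Pi.sub_apply] at h2 ⊢
      rw [h2]; ring
    rw [hsplit, integral_add hi1 hi2, hM.integral_mul_comp hZA hh.exp]
    have h0 : 0 ≤ ∫ ω, (A t).indicator Z ω ∂P :=
      integral_nonneg fun ω => Set.indicator_nonneg (fun _ _ => (Real.exp_pos _).le) ω
    have h1 : ∫ ω, (A t)ᶜ.indicator Z ω ∂P + ∫ ω, (A t).indicator Z ω ∂P = ∫ ω, Z ω ∂P := by
      rw [← integral_add hi1 (hZi.indicator hAt')]
      congr 1
      funext ω
      exact congrFun (Set.indicator_compl_add_self (A t) Z) ω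
    have h2 := mul_le_of_le_one_right h0 hexp
    linarith [ih (by omega)]

/-- Hoeffding's inequality for a predictable selection of at most `m` outcomes. -/
lemma measure_sum_indicator_ge_le [IsProbabilityMeasure P] (hM : M.IsRepeatedMarket P ℱ ξ) {T m : ℕ}
    {A : ℕ → Set Ω} (hA : ∀ t < T, MeasurableSet[ℱ t] (A t))
    (hcard : ∀ ω, ∑ r ∈ Finset.range T, (A r).indicator (fun _ => (1 : ℝ)) ω ≤ m)
    {g : X → ℝ} (hg : Measurable g) {B : ℝ} (hB : ∀ x, |g x| ≤ B)
    (hsub : HasSubgaussianMGF g 1 M.law) {c : ℝ} (hc : 0 ≤ c) :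
    P.real {ω | m * c ≤ ∑ r ∈ Finset.range T, (A r).indicator (fun ω => g (ξ r ω)) ω} ≤
      Real.exp (-(m * c ^ 2 / 2)) := by
  set h : X → ℝ := fun x => c * g x - c ^ 2 / 2 with hh
  have hhm : Measurable h := (hg.const_mul c).sub_const _
  have hhB : ∀ x, |h x| ≤ c * B + c ^ 2 / 2 := by
    intro x
    refine (abs_sub _ _).trans ?_
    rw [abs_mul, abs_of_nonneg hc, abs_of_nonneg (by positivity : 0 ≤ c ^ 2 / 2)]
    gcongr
    exact hB x
  have hexp : ∫ x, Real.exp (h x) ∂M.law ≤ 1 := by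
    have h1 := hsub.mgf_le c
    unfold mgf at h1
    have h2 : ∀ x, Real.exp (h x) = Real.exp (c * g x) * Real.exp (-(c ^ 2 / 2)) := by
      intro x
      rw [← Real.exp_add, hh]
      ring_nf
    simp_rw [h2]
    rw [integral_mul_const]
    calc _ ≤ Real.exp (((1 : NNReal) : ℝ) * c ^ 2 / 2) * Real.exp (-(c ^ 2 / 2)) := by gcongr
      _ = 1 := by rw [← Real.exp_add]; simp
  obtain ⟨hint, hle⟩ := hM.integral_exp_sum_indicator_le hA hhm hhB hexp le_rfl
  have hmarkov := mul_meas_ge_le_integral_of_nonneg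
    (Filter.Eventually.of_forall fun ω => (Real.exp_pos _).le) hint (Real.exp (m * c ^ 2 / 2))
  -- On the event the tilted sum is at least `m c²`, and the compensator is at most `m c² / 2`
  -- because at most `m` outcomes are selected.
  have hsubset : {ω | m * c ≤ ∑ r ∈ Finset.range T, (A r).indicator (fun ω => g (ξ r ω)) ω} ⊆
      {ω | Real.exp (m * c ^ 2 / 2) ≤
        Real.exp (∑ r ∈ Finset.range T, (A r).indicator (fun ω => h (ξ r ω)) ω)} := by
    intro ω hω
    simp only [Set.mem_ofPred_eq] at hω ⊢
    rw [Real.exp_le_exp]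
    have e : ∑ r ∈ Finset.range T, (A r).indicator (fun ω => h (ξ r ω)) ω =
        c * ∑ r ∈ Finset.range T, (A r).indicator (fun ω => g (ξ r ω)) ω -
          c ^ 2 / 2 * ∑ r ∈ Finset.range T, (A r).indicator (fun _ => (1 : ℝ)) ω := by
      rw [Finset.mul_sum, Finset.mul_sum, ← Finset.sum_sub_distrib]
      refine Finset.sum_congr rfl fun r _ => ?_
      by_cases hr : ω ∈ A r <;> simp [hr, hh]
    rw [e]
    have h1 := mul_le_mul_of_nonneg_left hω hc
    have h2 := mul_le_mul_of_nonneg_left (hcard ω) (by positivity : 0 ≤ c ^ 2 / 2)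
    linarith
  rw [Real.exp_neg, ← one_div, le_div_iff₀ (Real.exp_pos _), mul_comm]
  refine le_trans ?_ (hmarkov.trans hle)
  exact mul_le_mul_of_nonneg_left (measureReal_mono hsubset) (Real.exp_pos _).le

end IsRepeatedMarket

end DataMarket

/-! ### Probability that some confidence interval fails. -/

namespace DataMarket

variable {n k : ℕ} {X : Type*} [MeasurableSpace X] {M : DataMarket n k X} {α lam : ℝ} {i : Fin n}
  {Ω : Type*} {mΩ : MeasurableSpace Ω} {P : Measure Ω} {ℱ : Filtration ℕ mΩ} {ξ : ℕ → Ω → X}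
  {T : ℕ} {active : ℕ → Ω → Finset (SellerSet k)} {order : ℕ → Ω → SellerSet k} {γd : SellerSet k}

/-- The event that round `r` carries one of the first `m` orders of `γ`. -/
def firstPulls (order : ℕ → Ω → SellerSet k) (γ : SellerSet k) (m r : ℕ) : Set Ω :=
  {ω | order r ω = γ ∧ pullCount (fun s => order s ω) r γ < m}

lemma sum_indicator_firstPulls (γ : SellerSet k) (m : ℕ) (f : ℕ → Ω → ℝ) (ω : Ω) :
    ∑ r ∈ Finset.range T, (firstPulls order γ m r).indicator (f r) ω =
      ∑ r ∈ (Finset.range T).filter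
        (fun r => order r ω = γ ∧ pullCount (fun s => order s ω) r γ < m), f r ω := by
  rw [Finset.sum_filter]
  simp [firstPulls, Set.indicator_apply]

lemma sum_indicator_one_firstPulls_le (γ : SellerSet k) (m : ℕ) (ω : Ω) :
    ∑ r ∈ Finset.range T, (firstPulls order γ m r).indicator (fun _ => (1 : ℝ)) ω ≤ m := by
  rw [sum_indicator_firstPulls γ m (fun _ _ => (1 : ℝ)), Finset.sum_const, nsmul_eq_mul, mul_one,
    card_first_pulls (fun s => order s ω)]
  exact_mod_cast min_le_right _ _

namespace RunsZooming

lemma measurable_pullCount (h : M.RunsZooming α lam T i ℱ ξ active order) (γ : SellerSet k)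
    {t : ℕ} (ht : t ≤ T) : Measurable[ℱ t] fun ω => pullCount (fun s => order s ω) t γ := by
  induction t with
  | zero =>
    simp only [pullCount_zero]
    exact measurable_const
  | succ t ih =>
    simp only [pullCount_succ]
    refine Measurable.add ((ih (by omega)).mono (ℱ.mono (Nat.le_succ t)) le_rfl) ?_
    exact Measurable.ite (ℱ.mono (Nat.le_succ t) _ (h.nonanticipating t ht γ))
      measurable_const measurable_const

lemma measurableSet_firstPulls (h : M.RunsZooming α lam T i ℱ ξ active order) (γ : SellerSet k)
    (m : ℕ) {t : ℕ} (ht : t < T) : MeasurableSet[ℱ t] (firstPulls order γ m t) := by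
  refine MeasurableSet.inter (h.nonanticipating t ht γ) ?_
  exact h.measurable_pullCount γ ht.le (measurableSet_Iio (a := m))

end RunsZooming

/-- Deviation of the first `m` observed effective utilities of `γ`, with sign `σ`. -/
def deviationEvent (M : DataMarket n k X) (α : ℝ) (T : ℕ) (i : Fin n) (ξ : ℕ → Ω → X)
    (order : ℕ → Ω → SellerSet k) (σ : ℝ) (γ : SellerSet k) (m : ℕ) : Set Ω :=
  {ω | m * Real.sqrt (12 * Real.log T / ((m : ℝ) + 1)) ≤
    ∑ r ∈ Finset.range T, (firstPulls order γ m r).indicator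
      (fun ω => σ * (M.effUtility α i γ (ξ r ω) - M.meanEffUtility α i γ)) ω}

lemma measure_deviationEvent_le [IsProbabilityMeasure P] (hM : M.IsRepeatedMarket P ℱ ξ)
    (h : M.RunsZooming α lam T i ℱ ξ active order) (hα : α ∈ Set.Icc (0 : ℝ) 1) (hT : 2 ≤ T)
    {σ : ℝ} (hσ : σ = 1 ∨ σ = -1) (γ : SellerSet k) {m : ℕ} (hm : 1 ≤ m) :
    P.real (M.deviationEvent α T i ξ order σ γ m) ≤ ((T : ℝ) ^ 3)⁻¹ := by
  have hL := Real.log_natCast_nonneg T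
  have hT0 : (0 : ℝ) < T := by positivity
  have hm' : (1 : ℝ) ≤ m := by exact_mod_cast hm
  have hsub : HasSubgaussianMGF
      (fun x => σ * (M.effUtility α i γ x - M.meanEffUtility α i γ)) 1 M.law := by
    have h1 := M.hasSubgaussianMGF_effUtility hα i γ
    rcases hσ with rfl | rfl
    · simpa using h1
    · convert! h1.neg using 1
      funext x
      simp
  have hb := hM.measure_sum_indicator_ge_le (T := T) (m := m) (A := firstPulls order γ m)
    (fun t ht => h.measurableSet_firstPulls γ m ht)
    (fun ω => sum_indicator_one_firstPulls_le γ m ω)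
    (g := fun x => σ * (M.effUtility α i γ x - M.meanEffUtility α i γ))
    (((M.measurable_effUtility α i γ).sub_const _).const_mul σ) (B := 4)
    (fun x => by
      have h1 := M.abs_effUtility_le hα i γ x
      have h2 := M.abs_meanEffUtility_le hα i γ
      have h3 : |σ| = 1 := by rcases hσ with rfl | rfl <;> simp
      rw [abs_mul, h3, one_mul]
      exact (abs_sub _ _).trans (by linarith))
    hsub (Real.sqrt_nonneg (12 * Real.log T / ((m : ℝ) + 1)))
  refine hb.trans ?_
  rw [Real.sq_sqrt (by positivity), Real.exp_neg]
  refine inv_anti₀ (by positivity) ?_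
  have h3 : (T : ℝ) ^ 3 = Real.exp (3 * Real.log T) := by
    rw [mul_comm, Real.exp_mul, Real.exp_log hT0]
    norm_cast
  -- The exponent is `6 log T * m / (m + 1)`, at least `3 log T` since `m ≥ 1`.
  rw [h3, Real.exp_le_exp, ← mul_div_assoc, div_div, le_div_iff₀ (by positivity)]
  nlinarith

/-- Outside the deviation events all confidence intervals are correct. -/
lemma abs_empMean_sub_le (hα : α ∈ Set.Icc (0 : ℝ) 1) (hT : 2 ≤ T) {ω : Ω}
    (hω : ∀ σ : ℝ, σ = 1 ∨ σ = -1 → ∀ γ, ∀ m ∈ Finset.Icc 1 T,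
      ω ∉ M.deviationEvent α T i ξ order σ γ m) {t : ℕ} (ht : t < T) (γ : SellerSet k) :
    |M.empMean α i (fun t => ξ t ω) (fun t => order t ω) t γ - M.meanEffUtility α i γ| ≤
      confRadius T (fun t => order t ω) t γ := by
  rcases Nat.eq_zero_or_pos (pullCount (fun t => order t ω) t γ) with h0 | hpos
  -- Without orders the empirical mean is 0 by default, and the radius `√(12 log T)` exceeds the
  -- bound 2 on the true mean.
  · have h2 : (2 : ℝ) ≤ confRadius T (fun t => order t ω) t γ := by
      refine Real.le_sqrt_of_sq_le ?_
      rw [h0]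
      have h3 : Real.log 2 ≤ Real.log T := Real.log_le_log (by norm_num) (by exact_mod_cast hT)
      have := Real.log_two_gt_d9
      norm_num
      linarith
    unfold empMean
    rw [h0, Nat.cast_zero, div_zero, zero_sub, abs_neg]
    exact (M.abs_meanEffUtility_le hα i γ).trans h2
  · have hmem : pullCount (fun t => order t ω) t γ ∈ Finset.Icc 1 T :=
      Finset.mem_Icc.2 ⟨hpos, (pullCount_le _ _ _).trans ht.le⟩
    have hsum : ∀ σ : ℝ, ∑ r ∈ Finset.range T,
        (firstPulls order γ (pullCount (fun t => order t ω) t γ) r).indicator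
          (fun ω => σ * (M.effUtility α i γ (ξ r ω) - M.meanEffUtility α i γ)) ω =
        pullCount (fun t => order t ω) t γ * (σ *
          (M.empMean α i (fun t => ξ t ω) (fun t => order t ω) t γ - M.meanEffUtility α i γ)) := by
      intro σ
      rw [sum_indicator_firstPulls γ _
        (fun r ω => σ * (M.effUtility α i γ (ξ r ω) - M.meanEffUtility α i γ)),
        filter_first_pulls (fun s => order s ω) ht.le, ← Finset.mul_sum, Finset.sum_sub_distrib,
        Finset.sum_const, nsmul_eq_mul]
      have hne : (pullCount (fun t => order t ω) t γ : ℝ) ≠ 0 := by positivity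
      have he : ∑ s ∈ (Finset.range t).filter (fun s => order s ω = γ),
          M.effUtility α i γ (ξ s ω) = pullCount (fun t => order t ω) t γ *
            M.empMean α i (fun t => ξ t ω) (fun t => order t ω) t γ := by
        unfold empMean
        rw [mul_div_cancel₀ _ hne]
      rw [he]
      change σ * (_ - (pullCount (fun t => order t ω) t γ : ℝ) * _) = _
      ring
    have hpos' : (0 : ℝ) < pullCount (fun t => order t ω) t γ := by exact_mod_cast hpos
    have key : ∀ σ : ℝ, σ = 1 ∨ σ = -1 → σ *
        (M.empMean α i (fun t => ξ t ω) (fun t => order t ω) t γ - M.meanEffUtility α i γ) ≤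
        confRadius T (fun t => order t ω) t γ := by
      intro σ hσ
      have h1 := hω σ hσ γ _ hmem
      unfold deviationEvent at h1
      rw [Set.mem_ofPred_eq, hsum, not_le] at h1
      exact (lt_of_mul_lt_mul_left h1 hpos'.le).le
    have h1 := key 1 (Or.inl rfl)
    have h2 := key (-1) (Or.inr rfl)
    exact abs_le.2 ⟨by linarith, by linarith⟩

/-- With probability at least `1 - 2 ^ (k + 1) / T ^ 2` all confidence intervals are correct. -/
lemma exists_bad_event [IsProbabilityMeasure P] (hM : M.IsRepeatedMarket P ℱ ξ)
    (h : M.RunsZooming α lam T i ℱ ξ active order) (hα : α ∈ Set.Icc (0 : ℝ) 1) (hT : 2 ≤ T) :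
    ∃ bad : Set Ω, MeasurableSet bad ∧ P.real bad * (T : ℝ) ^ 2 ≤ 2 * (2 : ℝ) ^ k ∧
      ∀ ω ∉ bad, ∀ t < T, ∀ γ,
        |M.empMean α i (fun t => ξ t ω) (fun t => order t ω) t γ - M.meanEffUtility α i γ| ≤
          confRadius T (fun t => order t ω) t γ := by
  set S : Set Ω := ⋃ σ ∈ ({1, -1} : Finset ℝ), ⋃ γ ∈ (Finset.univ : Finset (SellerSet k)),
    ⋃ m ∈ Finset.Icc 1 T, M.deviationEvent α T i ξ order σ γ m with hS
  have hT0 : (0 : ℝ) < T := by positivity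
  have hbound : P.real S ≤ 2 * ((2 : ℝ) ^ k * (T * ((T : ℝ) ^ 3)⁻¹)) := by
    refine (measureReal_biUnion_finset_le _ _).trans ?_
    refine (Finset.sum_le_card_nsmul _ _ ((2 : ℝ) ^ k * (T * ((T : ℝ) ^ 3)⁻¹)) fun σ hσ => ?_).trans
      ?_
    · refine (measureReal_biUnion_finset_le _ _).trans ?_
      refine (Finset.sum_le_card_nsmul _ _ (T * ((T : ℝ) ^ 3)⁻¹) fun γ _ => ?_).trans ?_
      · refine (measureReal_biUnion_finset_le _ _).trans ?_
        refine (Finset.sum_le_card_nsmul _ _ (((T : ℝ) ^ 3)⁻¹) fun m hm => ?_).trans ?_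
        · exact measure_deviationEvent_le hM h hα hT (by simpa using hσ) γ (Finset.mem_Icc.1 hm).1
        · simp
      · simp
    · rw [nsmul_eq_mul]
      refine mul_le_mul_of_nonneg_right ?_ (by positivity)
      exact_mod_cast Finset.card_le_two
  -- The measurable hull has the same probability, and its indicator can be integrated later.
  refine ⟨toMeasurable P S, measurableSet_toMeasurable _ _, ?_, fun ω hω t ht γ => ?_⟩
  · have h1 : P.real (toMeasurable P S) = P.real S := by
      simp only [Measure.real, measure_toMeasurable]
    rw [h1]
    refine (mul_le_mul_of_nonneg_right hbound (by positivity)).trans (le_of_eq ?_)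
    field_simp
  · refine abs_empMean_sub_le hα hT (fun σ hσ γ m hm hmem => hω (subset_toMeasurable P S ?_)) ht γ
    simp only [hS, Set.mem_iUnion]
    exact ⟨σ, by simpa using hσ, γ, Finset.mem_univ _, m, hm, hmem⟩

/-! ### From gaps to expected regret. -/

lemma integrable_comp_order [IsProbabilityMeasure P]
    (h : M.RunsZooming α lam T i ℱ ξ active order) {t : ℕ} (ht : t < T) (g : SellerSet k → ℝ) :
    Integrable (fun ω => g (order t ω)) P := by
  have e : (fun ω => g (order t ω)) =
      fun ω => ∑ γ, {ω | order t ω = γ}.indicator (fun _ => g γ) ω := by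
    funext ω
    simp [Set.indicator_apply]
  rw [e]
  refine integrable_finsetSum _ fun γ _ => ?_
  exact (integrable_const _).indicator (ℱ.le t _ (h.nonanticipating t ht γ))

/-- The expected regret is the expected sum of the gaps of the orders. -/
lemma effRegret_eq [IsProbabilityMeasure P] (hM : M.IsRepeatedMarket P ℱ ξ)
    (h : M.RunsZooming α lam T i ℱ ξ active order) (hα : α ∈ Set.Icc (0 : ℝ) 1)
    (γd : SellerSet k) :
    M.effRegret α i P ξ order γd T =
      ∫ ω, ∑ t ∈ Finset.range T, M.gap α i γd (order t ω) ∂P := by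
  have hd : ∀ γ, Measurable fun x => M.effUtility α i γd x - M.effUtility α i γ x := fun γ =>
    (M.measurable_effUtility α i γd).sub (M.measurable_effUtility α i γ)
  have hdi : ∀ t γ, Integrable
      (fun ω => M.effUtility α i γd (ξ t ω) - M.effUtility α i γ (ξ t ω)) P := by
    intro t γ
    refine Integrable.of_bound ((hd γ).comp (hM.measurable t)).aestronglyMeasurable 4
      (Filter.Eventually.of_forall fun ω => ?_)
    refine (abs_sub _ _).trans ?_
    linarith [M.abs_effUtility_le hα i γd (ξ t ω), M.abs_effUtility_le hα i γ (ξ t ω)]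
  -- Splitting over the finitely many orders separates the indicator, known before round `t`, from
  -- the fresh outcome; independence then factors each term.
  have hsplit : ∀ t, (fun ω => M.effUtility α i γd (ξ t ω) - M.effUtility α i (order t ω) (ξ t ω)) =
      fun ω => ∑ γ, {ω | order t ω = γ}.indicator (fun _ => (1 : ℝ)) ω *
        (M.effUtility α i γd (ξ t ω) - M.effUtility α i γ (ξ t ω)) := by
    intro t
    funext ω
    simp [Set.indicator_apply]
  have hterm : ∀ t < T, ∀ γ, Integrable (fun ω =>
      {ω | order t ω = γ}.indicator (fun _ => (1 : ℝ)) ω *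
        (M.effUtility α i γd (ξ t ω) - M.effUtility α i γ (ξ t ω))) P := by
    intro t ht γ
    refine ((hdi t γ).indicator (ℱ.le t _ (h.nonanticipating t ht γ))).congr
      (Filter.Eventually.of_forall fun ω => ?_)
    simp [Set.indicator_apply]
  unfold effRegret
  rw [integral_finsetSum, integral_finsetSum]
  · refine Finset.sum_congr rfl fun t ht => ?_
    rw [Finset.mem_range] at ht
    have e : (fun ω => M.gap α i γd (order t ω)) =
        fun ω => ∑ γ, {ω | order t ω = γ}.indicator (fun _ => (1 : ℝ)) ω * M.gap α i γd γ := by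
      funext ω
      simp [Set.indicator_apply]
    rw [hsplit, e, integral_finsetSum _ fun γ _ => hterm t ht γ, integral_finsetSum]
    · refine Finset.sum_congr rfl fun γ _ => ?_
      rw [hM.integral_mul_comp (measurable_const.indicator (h.nonanticipating t ht γ)) (hd γ),
        integral_mul_const, integral_sub (M.integrable_effUtility hα i γd)
          (M.integrable_effUtility hα i γ)]
      rfl
    · intro γ _
      exact ((integrable_const _).indicator (ℱ.le t _ (h.nonanticipating t ht γ))).mul_const _
  · exact fun t ht => integrable_comp_order h (Finset.mem_range.1 ht) _
  · intro t ht
    rw [hsplit]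
    exact integrable_finsetSum _ fun γ _ => hterm t (Finset.mem_range.1 ht) γ

lemma effRegret_le_lam_mul [IsProbabilityMeasure P] (hM : M.IsRepeatedMarket P ℱ ξ)
    (h : M.RunsZooming α lam T i ℱ ξ active order) (hα : α ∈ Set.Icc (0 : ℝ) 1) (hlam : 0 < lam)
    (hcl : M.Closeness α lam i γd) : M.effRegret α i P ξ order γd T ≤ lam * T := by
  rw [effRegret_eq hM h hα]
  refine (integral_mono (g := fun _ => lam * T)
    (integrable_finsetSum _ fun t ht => integrable_comp_order h (Finset.mem_range.1 ht) _)
    (integrable_const _) fun ω => ?_).trans (by simp)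
  refine (Finset.sum_le_card_nsmul _ _ lam fun t _ => hcl.gap_le_lam hlam _).trans ?_
  simp [mul_comm]

lemma effRegret_le [IsProbabilityMeasure P] (hM : M.IsRepeatedMarket P ℱ ξ)
    (h : M.RunsZooming α lam T i ℱ ξ active order) (hα : α ∈ Set.Icc (0 : ℝ) 1) (hlam : 0 < lam)
    (hcl : M.Closeness α lam i γd) (hk : 1 ≤ k) (hT : 2 ≤ T)
    (hlog : lam ^ 2 ≤ 12 * Real.log T) :
    M.effRegret α i P ξ order γd T ≤
      (k + 1) * (11 * Real.sqrt (T * Real.log T)) +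
        k * (160 * (2 : ℝ) ^ (3 * (k : ℝ) / 4)) * (108 * Real.log T * k / lam) +
        lam * (2 * (2 : ℝ) ^ k / T) := by
  obtain ⟨bad, hbad, hprob, hclean⟩ := exists_bad_event hM h hα hT
  have hL := Real.log_natCast_nonneg T
  have hT0 : (0 : ℝ) < T := by positivity
  set b : ℝ := (k + 1) * (11 * Real.sqrt (T * Real.log T)) +
    k * (160 * (2 : ℝ) ^ (3 * (k : ℝ) / 4)) * (108 * Real.log T * k / lam) with hb
  have hb0 : 0 ≤ b := by positivity
  rw [effRegret_eq hM h hα]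
  refine (integral_mono (g := fun ω => b + bad.indicator (fun _ => lam * T) ω)
    (integrable_finsetSum _ fun t ht => integrable_comp_order h (Finset.mem_range.1 ht) _)
    ((integrable_const _).add ((integrable_const _).indicator hbad)) fun ω => ?_).trans ?_
  · by_cases hω : ω ∈ bad
    · dsimp only
      rw [Set.indicator_of_mem hω]
      have h1 : ∑ t ∈ Finset.range T, M.gap α i γd (order t ω) ≤ lam * T := by
        refine (Finset.sum_le_card_nsmul _ _ lam fun t _ => hcl.gap_le_lam hlam _).trans ?_
        simp [mul_comm]
      linarith
    · dsimp only
      rw [Set.indicator_of_notMem hω, add_zero]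
      exact (h.path ω).sum_gap_le hlam hk hlog hcl (hclean ω hω)
  · rw [integral_add (integrable_const _) ((integrable_const _).indicator hbad),
      integral_indicator_const _ hbad]
    simp only [integral_const, probReal_univ, smul_eq_mul, one_mul]
    gcongr b + ?_
    rw [mul_comm, mul_assoc]
    gcongr
    rw [le_div_iff₀ hT0]
    linarith

end DataMarket

/-! ### Assembling the constant. -/

theorem mainTheorem1 (lam : ℝ) (hlam : 0 < lam) :
    ∃ C : ℝ, 0 < C ∧
      ∀ (n k : ℕ) (X : Type*) [MeasurableSpace X] (M : DataMarket n k X)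
        (α : ℝ) (_ : α ∈ Set.Icc (0 : ℝ) 1) (T : ℕ) (_ : 2 ≤ T)
        (Ω : Type*) [mΩ : MeasurableSpace Ω] (P : Measure Ω) [IsProbabilityMeasure P]
        (ℱ : Filtration ℕ mΩ) (ξ : ℕ → Ω → X) (_ : M.IsRepeatedMarket P ℱ ξ)
        (i : Fin n) (γd : SellerSet k) (_ : M.IsDominantStrategy α i γd)
        (_ : M.Closeness α lam i γd)
        (active : ℕ → Ω → Finset (SellerSet k)) (order : ℕ → Ω → SellerSet k)
        (_ : M.RunsZooming α lam T i ℱ ξ active order),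
        M.effRegret α i P ξ order γd T ≤
          C * ((k : ℝ) ^ 2 * Real.sqrt (T * Real.log T)) +
            C * ((k : ℝ) ^ 3 * Real.log T ^ 2 * (2 : ℝ) ^ (3 * (k : ℝ) / 4)) := by
  -- The summands pay, in order, for the unit ball, for horizons with `12 log T < lam²`, for the far
  -- sets (`160 * 108 * 2`, using `log T ≤ 2 log² T`), and for the failure event or the case `T ≤
  -- Q`.
  refine ⟨22 + lam * Real.exp (lam ^ 2 / 12) + 34560 / lam + 8 * lam, by positivity, ?_⟩
  intro n k X _ M α hα T hT Ω _ P _ ℱ ξ hM i γd _ hcl active order hrun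
  set C : ℝ := 22 + lam * Real.exp (lam ^ 2 / 12) + 34560 / lam + 8 * lam with hC
  have hT2 : (2 : ℝ) ≤ T := by exact_mod_cast hT
  have hL : 1 / 2 ≤ Real.log T := by
    have h1 : Real.log 2 ≤ Real.log T := Real.log_le_log (by norm_num) hT2
    linarith [Real.log_two_gt_d9]
  have hL0 : 0 < Real.log T := by linarith
  have hC0 : 0 < C := by positivity
  -- For `k = 0` the bound is 0, and so is the regret: there is only one seller set.
  rcases Nat.eq_zero_or_pos k with rfl | hk
  · have h0 : ∀ t ω, order t ω = γd := fun t ω => Subsingleton.elim _ _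
    simp [DataMarket.effRegret, h0]
  have hk1 : (1 : ℝ) ≤ k := by exact_mod_cast hk
  set Q : ℝ := (2 : ℝ) ^ (3 * (k : ℝ) / 4) with hQ
  have hQ1 : 1 ≤ Q := Real.one_le_rpow (by norm_num) (by positivity)
  have hS1 : 1 ≤ Real.sqrt (T * Real.log T) := Real.one_le_sqrt.2 (by nlinarith)
  set S : ℝ := Real.sqrt (T * Real.log T) with hS
  have hterm1 : 1 ≤ (k : ℝ) ^ 2 * S := one_le_mul_of_one_le_of_one_le (one_le_pow₀ hk1) hS1
  have hL2 : 1 / 4 ≤ Real.log T ^ 2 := by nlinarith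
  have hterm2 : 1 / 4 * Q ≤ (k : ℝ) ^ 3 * Real.log T ^ 2 * Q := by
    have h3 : 1 ≤ (k : ℝ) ^ 3 := one_le_pow₀ hk1
    gcongr
    nlinarith
  have hpos2 : 0 < (k : ℝ) ^ 3 * Real.log T ^ 2 * Q := by positivity
  have htriv := DataMarket.effRegret_le_lam_mul hM hrun hα hlam hcl
  have hc1 : 0 < lam * Real.exp (lam ^ 2 / 12) := by positivity
  have hc2 : 0 < 34560 / lam := by positivity
  rcases lt_or_ge (12 * Real.log T) (lam ^ 2) with hsmall | hlog
  · have h1 : (T : ℝ) ≤ Real.exp (lam ^ 2 / 12) := by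
      rw [← Real.exp_log (by positivity : (0 : ℝ) < T), Real.exp_le_exp]
      linarith
    calc _ ≤ lam * T := htriv
      _ ≤ lam * Real.exp (lam ^ 2 / 12) := by gcongr
      _ ≤ C := by linarith
      _ ≤ C * ((k : ℝ) ^ 2 * S) := le_mul_of_one_le_right hC0.le hterm1
      _ ≤ _ := le_add_of_nonneg_right (by positivity)
  rcases le_or_gt (T : ℝ) Q with hTQ | hTQ
  · calc _ ≤ lam * T := htriv
      _ ≤ lam * Q := by gcongr
      _ ≤ 4 * lam * (1 / 4 * Q) := by linarith
      _ ≤ C * ((k : ℝ) ^ 3 * Real.log T ^ 2 * Q) := by gcongr; linarith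
      _ ≤ _ := le_add_of_nonneg_left (by positivity)
  have hbound := DataMarket.effRegret_le hM hrun hα hlam hcl hk hT hlog
  -- Here `T > Q`, and `Q² = 2 ^ (3k/2)` dominates `2 ^ k`.
  have hkQ : (2 : ℝ) ^ k / T ≤ Q := by
    rw [div_le_iff₀ (by positivity)]
    calc (2 : ℝ) ^ k ≤ Q * Q := by
          rw [hQ, ← Real.rpow_add (by norm_num), ← Real.rpow_natCast]
          exact Real.rpow_le_rpow_of_exponent_le (by norm_num) (by linarith)
      _ ≤ Q * T := by gcongr
  have hA : ((k : ℝ) + 1) * (11 * S) ≤ 22 * ((k : ℝ) ^ 2 * S) := by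
    have h1 : (k : ℝ) + 1 ≤ 2 * (k : ℝ) ^ 2 := by nlinarith
    nlinarith
  have hB : (k : ℝ) * (160 * Q) * (108 * Real.log T * k / lam) ≤
      34560 / lam * ((k : ℝ) ^ 3 * Real.log T ^ 2 * Q) := by
    have e1 : (k : ℝ) * (160 * Q) * (108 * Real.log T * k / lam) =
        34560 / lam * ((k : ℝ) ^ 2 * (1 / 2 * Real.log T) * Q) := by ring
    rw [e1, pow_two (Real.log T)]
    gcongr
    norm_num
  have hD : lam * (2 * (2 : ℝ) ^ k / T) ≤ 8 * lam * ((k : ℝ) ^ 3 * Real.log T ^ 2 * Q) := by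
    calc lam * (2 * (2 : ℝ) ^ k / T) = 2 * lam * ((2 : ℝ) ^ k / T) := by ring
      _ ≤ 2 * lam * Q := by gcongr
      _ = 8 * lam * (1 / 4 * Q) := by ring
      _ ≤ _ := by gcongr
  have hE : 22 * ((k : ℝ) ^ 2 * S) ≤ C * ((k : ℝ) ^ 2 * S) := by
    gcongr; linarith
  have hF : (34560 / lam + 8 * lam) * ((k : ℝ) ^ 3 * Real.log T ^ 2 * Q) ≤
      C * ((k : ℝ) ^ 3 * Real.log T ^ 2 * Q) := by
    gcongr; linarith
  linarith
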